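/- Let $\mathfrak H=\mathbb Q\langle x,y\rangle$ be the noncommutative polynomial algebra over $\mathbb Q$ in two indeterminates $x,y$, and let $z=x+y$. Let $\sqcup\!\sqcup$ be the shuffle product on $\mathfrak H$, i.e. the $\mathbb Q$-bilinear map determined by $1 \mathbin{\sqcup\!\sqcup} w=w \mathbin{\sqcup\!\sqcup} 1=w$ and $uw \mathbin{\sqcup\!\sqcup} vw'=u(w \mathbin{\sqcup\!\sqcup} vw')+v(uw \mathbin{\sqcup\!\sqcup} w')$ for $u,v\in\{x,y\}$ and $w,w'\in\mathfrak H$. For $n\ge 1$ let $\partial_n:\mathfrak H\to\mathfrak H$ be the $\mathbb Q$-linear derivation with $\partial_n(x)=xz^{n-1}y$ and $\partial_n(y)=-xz^{n-1}y$. Then for all integers $a,b\ge 0$ and $k\ge a+b+2$, $$x\bigl(x^{k-a-b-2} \mathbin{\sqcup\!\sqcup} y^b\bigr)y^{a+1}-x^{k-a-b-1}\bigl(x^b \mathbin{\sqcup\!\sqcup} y^a\bigr)y\ \in\ \sum_{n\ge 1}\partial_n(x\mathfrak H y),$$ where the right-hand side is the sum of the $\mathbb Q$-subspaces $\partial_n(x\mathfrak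 H y)=\{\partial_n(xwy):w\in\mathfrak H\}$ of $\mathfrak H$. -/

import Mathlib

namespace MZV

/-- The two indeterminates. -/
inductive Letter where
  | X
  | Y

/-- The noncommutative polynomial algebra `ℚ⟨x, y⟩`. -/
abbrev H : Type := FreeAlgebra ℚ Letter

/-- The indeterminate `x`. -/
def x : H := FreeAlgebra.ι ℚ Letter.X

/-- The indeterminate `y`. -/
def y : H := FreeAlgebra.ι ℚ Letter.Y

/-- The element `z = x + y`. -/
def z : H := x + y

/-- The word (noncommutative monomial) of `ℚ⟨x, y⟩` spelled by a list of letters. -/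
def word (l : List Letter) : H := (l.map (FreeAlgebra.ι ℚ)).prod

/-- The shuffle product of two words: `1 ш w = w ш 1 = w` and
`u w ш v w' = u (w ш v w') + v (u w ш w')` for letters `u`, `v`. -/
def wordShuffle : List Letter → List Letter → H
  | [], w => word w
  | u :: w, [] => word (u :: w)
  | u :: w, v :: w' =>
      FreeAlgebra.ι ℚ u * wordShuffle w (v :: w') + FreeAlgebra.ι ℚ v * wordShuffle (u :: w) w'
termination_by w w' => w.length + w'.length

/-- The shuffle product on `ℚ⟨x, y⟩`: the bilinear extension of `wordShuffle` from the basis of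
words. -/
noncomputable def shuffle : H →ₗ[ℚ] H →ₗ[ℚ] H :=
  (FreeAlgebra.basisFreeMonoid ℚ Letter).constr ℚ fun w =>
    (FreeAlgebra.basisFreeMonoid ℚ Letter).constr ℚ fun w' =>
      wordShuffle (FreeMonoid.toList w) (FreeMonoid.toList w')

/-- The algebra homomorphism `w ↦ w + ε D(w)` to the dual numbers over `ℚ⟨x, y⟩` (with `ε`
central and `ε ^ 2 = 0`) that sends a letter `i` to `i + ε f(i)`. -/
noncomputable def dualLift (f : Letter → H) : H →ₐ[ℚ] TrivSqZeroExt H H :=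
  FreeAlgebra.lift ℚ fun i => TrivSqZeroExt.inl (FreeAlgebra.ι ℚ i) + TrivSqZeroExt.inr (f i)

/-- The derivation of `ℚ⟨x, y⟩` with prescribed values `f` on the letters. -/
noncomputable def derivationOf (f : Letter → H) : H →ₗ[ℚ] H :=
  (TrivSqZeroExt.sndHom H H).restrictScalars ℚ ∘ₗ (dualLift f).toLinearMap

/-- The derivation `∂ₙ` with `∂ₙ(x) = x z ^ (n - 1) y` and `∂ₙ(y) = - x z ^ (n - 1) y`; it is only
meant for `n ≥ 1`. -/
noncomputable def partialD (n : ℕ) : H →ₗ[ℚ] H :=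
  derivationOf fun
    | Letter.X => x * z ^ (n - 1) * y
    | Letter.Y => -(x * z ^ (n - 1) * y)

/-- The subspace `x ℚ⟨x, y⟩ y = {x w y}`. -/
noncomputable def xHy : Submodule ℚ H :=
  LinearMap.range (LinearMap.mulLeft ℚ x ∘ₗ LinearMap.mulRight ℚ y)

/-- The subspace `∑_{n ≥ 1} ∂ₙ(x ℚ⟨x, y⟩ y)`. -/
noncomputable def derivationRelations : Submodule ℚ H :=
  ⨆ (n : ℕ) (_ : 1 ≤ n), xHy.map (partialD n)

theorem basis_word (l : List Letter) :
    FreeAlgebra.basisFreeMonoid ℚ Letter (FreeMonoid.ofList l) = word l := by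
  simp only [FreeAlgebra.basisFreeMonoid, Module.Basis.map_apply, Finsupp.coe_basisSingleOne,
    word, FreeAlgebra.equivMonoidAlgebraFreeMonoid]
  change MonoidAlgebra.lift ℚ H (FreeMonoid Letter) (FreeMonoid.lift (FreeAlgebra.ι ℚ))
    (MonoidAlgebra.single (FreeMonoid.ofList l) 1) = _
  simp [FreeMonoid.lift_apply]

/-- On words the shuffle product is `wordShuffle`. -/
theorem shuffle_word (w w' : List Letter) : shuffle (word w) (word w') = wordShuffle w w' := by
  simp only [← basis_word, shuffle, Module.Basis.constr_basis, FreeMonoid.toList_ofList]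

theorem fst_dualLift (f : Letter → H) (w : H) : (dualLift f w).fst = w := by
  have h : (TrivSqZeroExt.fstHom ℚ H H).comp (dualLift f) = AlgHom.id ℚ H := by
    apply FreeAlgebra.hom_ext
    funext i
    simp [dualLift]
  exact DFunLike.congr_fun h w

/-- `derivationOf f` takes the prescribed values on the letters. -/
theorem derivationOf_ι (f : Letter → H) (i : Letter) :
    derivationOf f (FreeAlgebra.ι ℚ i) = f i := by
  simp [derivationOf, dualLift]

/-- The Leibniz rule. -/
theorem derivationOf_mul (f : Letter → H) (w w' : H) :
    derivationOf f (w * w') = derivationOf f w * w' + w * derivationOf f w' := by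
  simp [derivationOf, fst_dualLift, add_comm]

theorem partialD_x (n : ℕ) : partialD n x = x * z ^ (n - 1) * y :=
  derivationOf_ι _ _

theorem partialD_y (n : ℕ) : partialD n y = -(x * z ^ (n - 1) * y) :=
  derivationOf_ι _ _

end MZV

namespace MZV

open PowerSeries Finset

/-! ### Power series over a noncommutative ring -/

section PowerSeriesLemmas

variable {R : Type*} [Ring R]

/-! Let Φ = `expD` = exp(∑ Xⁿ∂ₙ/n). Differentiating in X expresses n times the n-th coefficient of
Φ(v) through the ∂ᵢ of lower ones (`coeff_expD`). So for v ∈ x𝔥y every coefficient of positive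
degree is a derivation relation, while the constant one is v. Since Φ(1 - Xx) = (1 - Xz)(1 - Xy)⁻¹
and Φ(y) = (1 - Xz)y(1 - Xy)⁻¹, extending Φ by X ↦ X gives Φ((1 - Xx)⁻¹y) = y. Now ∑ Xʲ(xʲ ш yᵃ)y =
((1 - Xx)⁻¹y)ᵃ⁺¹ maps to yᵃ⁺¹, and Φ(x)ᵐ⁺¹ has b-th coefficient x(xᵐ ш yᵇ). Comparing coefficients
of Xᵇ (`sum_coeff_expD_eq`) writes the first term of the claim as a sum over j ≤ b, whose j = b
summand is the second term. -/

theorem X_pow_dvd_mul_left {n : ℕ} {f : R⟦X⟧} (g : R⟦X⟧) (h : (X : R⟦X⟧) ^ n ∣ f) :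
    (X : R⟦X⟧) ^ n ∣ g * f := by
  obtain ⟨c, rfl⟩ := h
  exact ⟨g * c, by rw [← mul_assoc, ← mul_assoc, (commute_X_pow g n).eq]⟩

/-- If `f ≡ g * X * f` modulo `X ^ N` then `f ≡ 0` modulo `X ^ N`. -/
theorem X_pow_dvd_of_dvd_sub {N : ℕ} {f g : R⟦X⟧} (h : (X : R⟦X⟧) ^ N ∣ f - g * (X * f)) :
    (X : R⟦X⟧) ^ N ∣ f := by
  suffices ∀ k ≤ N, (X : R⟦X⟧) ^ k ∣ f from this N le_rfl
  intro k
  induction k with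
  | zero => simp
  | succ k ih =>
    intro hk
    have h1 : (X : R⟦X⟧) ^ (k + 1) ∣ g * (X * f) := by
      apply X_pow_dvd_mul_left
      rw [pow_succ']
      exact mul_dvd_mul_left _ (ih (by omega))
    have h2 := dvd_add ((pow_dvd_pow _ hk).trans h) h1
    rwa [sub_add_cancel] at h2

/-- The Euler operator `X * d/dX`. -/
noncomputable def euler (f : R⟦X⟧) : R⟦X⟧ := PowerSeries.mk fun n => (n : R) * coeff n f

theorem euler_mul (f g : R⟦X⟧) : euler (f * g) = euler f * g + f * euler g := by
  ext n
  simp only [euler, coeff_mk, coeff_mul, map_add, mul_sum, ← sum_add_distrib]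
  refine sum_congr rfl fun p hp => ?_
  rw [← mem_antidiagonal.1 hp, Nat.cast_add, add_mul, mul_assoc, ← mul_assoc (coeff p.1 f),
    ← (Nat.cast_commute p.2 (coeff p.1 f)).eq, mul_assoc]

theorem euler_add (f g : R⟦X⟧) : euler (f + g) = euler f + euler g := by
  ext n
  simp [euler, mul_add]

end PowerSeriesLemmas

/-! ### The derivations ∂ₙ on power series -/

theorem partialD_mul (n : ℕ) (w w' : H) :
    partialD n (w * w') = partialD n w * w' + w * partialD n w' :=
  derivationOf_mul _ _ _

theorem partialD_z (n : ℕ) : partialD n z = 0 := by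
  rw [z, map_add, partialD_x, partialD_y, add_neg_cancel]

theorem partialD_one (n : ℕ) : partialD n 1 = 0 := by
  have h := partialD_mul n 1 1
  simpa using h

/-- The coefficientwise extension of `∂ₙ` to power series. -/
noncomputable def coeffD (n : ℕ) (f : H⟦X⟧) : H⟦X⟧ :=
  PowerSeries.mk fun m => partialD n (coeff m f)

theorem coeffD_mul (n : ℕ) (f g : H⟦X⟧) : coeffD n (f * g) = coeffD n f * g + f * coeffD n g := by
  ext m
  simp only [coeffD, coeff_mk, coeff_mul, map_add, map_sum, partialD_mul, sum_add_distrib]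

theorem coeffD_add (n : ℕ) (f g : H⟦X⟧) : coeffD n (f + g) = coeffD n f + coeffD n g := by
  ext m
  simp [coeffD]

/-- The derivation `∑_{1 ≤ i ≤ N} X ^ i ∂ᵢ` on power series. -/
noncomputable def totalD (N : ℕ) (f : H⟦X⟧) : H⟦X⟧ :=
  ∑ i ∈ range N, X ^ (i + 1) * coeffD (i + 1) f

theorem totalD_mul (N : ℕ) (f g : H⟦X⟧) :
    totalD N (f * g) = totalD N f * g + f * totalD N g := by
  simp only [totalD, coeffD_mul, sum_mul, mul_sum, ← sum_add_distrib]
  refine sum_congr rfl fun i _ => ?_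
  rw [mul_add, mul_assoc, ← mul_assoc f, (commute_X_pow f (i + 1)).eq, mul_assoc]

theorem totalD_add (N : ℕ) (f g : H⟦X⟧) : totalD N (f + g) = totalD N f + totalD N g := by
  simp only [totalD, coeffD_add, mul_add, sum_add_distrib]

theorem coeff_totalD (N n : ℕ) (hn : n ≤ N) (f : H⟦X⟧) :
    coeff n (totalD N f) = ∑ i ∈ range n, partialD (i + 1) (coeff (n - (i + 1)) f) := by
  have h : ∀ i, coeff n (X ^ (i + 1) * coeffD (i + 1) f)
      = if i < n then partialD (i + 1) (coeff (n - (i + 1)) f) else 0 := by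
    intro i
    rw [coeff_X_pow_mul']
    simp [coeffD]
  simp only [totalD, map_sum, h]
  rw [← sum_filter]
  congr 1
  ext i
  simp only [mem_filter, mem_range]
  omega

/-! ### The exponential homomorphism and its differential equation -/

/-- The series `x (1 - X y)⁻¹`. -/
noncomputable def xSeries : H⟦X⟧ := PowerSeries.mk fun n => x * y ^ n

theorem xSeries_eq : xSeries = C x + xSeries * (X * C y) := by
  ext n
  cases n with
  | zero => simp [xSeries, X_mul, ← mul_assoc]
  | succ n =>
    rw [X_mul, ← mul_assoc, map_add, coeff_succ_mul_X, coeff_mul_C]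
    simp [xSeries, pow_succ, mul_assoc]

/-- The homomorphism fixing `z` and sending `x` to `x (1 - X y)⁻¹`; it is
`exp (∑_{n ≥ 1} X ^ n ∂ₙ / n)`. -/
noncomputable def expD : H →ₐ[ℚ] H⟦X⟧ :=
  FreeAlgebra.lift ℚ fun
    | Letter.X => xSeries
    | Letter.Y => C z - xSeries

theorem expD_x : expD x = xSeries := by simp [expD, x]

theorem expD_y : expD y = C z - xSeries := by simp [expD, y]

/-- Sorts the words of length n by the position of their first x. -/
theorem z_pow_eq (n : ℕ) :
    z ^ n = y ^ n + ∑ i ∈ range n, y ^ (n - (i + 1)) * x * z ^ i := by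
  induction n with
  | zero => simp
  | succ n ih =>
    rw [sum_range_succ, Nat.sub_self, pow_zero, one_mul]
    have h : ∑ i ∈ range n, y ^ (n + 1 - (i + 1)) * x * z ^ i
        = y * ∑ i ∈ range n, y ^ (n - (i + 1)) * x * z ^ i := by
      rw [mul_sum]
      refine sum_congr rfl fun i hi => ?_
      rw [show n + 1 - (i + 1) = (n - (i + 1)) + 1 by have := mem_range.1 hi; omega, pow_succ']
      simp only [mul_assoc]
    rw [h, ← add_assoc, pow_succ' y, ← mul_add, ← ih, ← add_mul, pow_succ', z, add_comm x y]

theorem sum_partialD_x_mul_y_pow (n : ℕ) :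
    ∑ i ∈ range n, partialD (i + 1) (x * y ^ (n - (i + 1))) = (n : H) * (x * y ^ n) := by
  induction n with
  | zero => simp
  | succ n ih =>
    have h : ∀ i ∈ range n, partialD (i + 1) (x * y ^ (n + 1 - (i + 1)))
        = partialD (i + 1) (x * y ^ (n - (i + 1))) * y
          - x * (y ^ (n - (i + 1)) * x * z ^ i) * y := by
      intro i hi
      rw [show n + 1 - (i + 1) = (n - (i + 1)) + 1 by have := mem_range.1 hi; omega, pow_succ,
        ← mul_assoc, partialD_mul, partialD_y, Nat.add_sub_cancel]
      simp only [mul_neg, sub_eq_add_neg, mul_assoc]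
    -- By `z_pow_eq` the subtracted terms total x(zⁿ - yⁿ)y; the new term ∂ₙ₊₁(x) = xzⁿy cancels all
    -- but xyⁿ⁺¹.
    rw [sum_range_succ, sum_congr rfl h, sum_sub_distrib, ← sum_mul, ← sum_mul, ← mul_sum, ih,
      Nat.sub_self, pow_zero, mul_one, partialD_x, Nat.add_sub_cancel]
    rw [z_pow_eq n, pow_succ]
    push_cast
    noncomm_ring

/-- Both operators composed with `expD` are derivations along `expD`, so agreement on letters
suffices. -/
theorem euler_expD_dvd (N : ℕ) (w : H) :
    (X : H⟦X⟧) ^ (N + 1) ∣ euler (expD w) - totalD N (expD w) := by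
  have hC : ∀ c : H, (∀ n, partialD n c = 0) → euler (C c) - totalD N (C c) = 0 := by
    intro c hc
    have h1 : euler (C c) = 0 := by
      ext n
      cases n <;> simp [euler, coeff_C]
    have h2 : ∀ i, coeffD i (C c) = 0 := by
      intro i
      ext n
      cases n <;> simp [coeffD, coeff_C, hc]
    simp [h1, totalD, h2]
  have hadd : ∀ f g : H⟦X⟧, euler (f + g) - totalD N (f + g)
      = (euler f - totalD N f) + (euler g - totalD N g) := by
    intro f g
    rw [euler_add, totalD_add]
    abel
  have hx : (X : H⟦X⟧) ^ (N + 1) ∣ euler xSeries - totalD N xSeries := by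
    rw [X_pow_dvd_iff]
    intro n hn
    rw [map_sub, coeff_totalD N n (by omega)]
    simp only [euler, xSeries, coeff_mk]
    rw [sum_partialD_x_mul_y_pow, sub_self]
  induction w using FreeAlgebra.induction with
  | grade0 r =>
    have h : expD (algebraMap ℚ H r) = C (algebraMap ℚ H r) := by
      rw [AlgHom.commutes, PowerSeries.algebraMap_apply]
    rw [h, hC]
    · exact dvd_zero _
    · intro n
      rw [Algebra.algebraMap_eq_smul_one, map_smul, partialD_one, smul_zero]
  | grade1 l =>
    cases l with
    | X => rw [show FreeAlgebra.ι ℚ Letter.X = x from rfl, expD_x]; exact hx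
    | Y =>
      rw [show FreeAlgebra.ι ℚ Letter.Y = y from rfl, expD_y]
      -- Both operators kill z = x + y, so the defect at y is minus that at x.
      have h := hadd (C z - xSeries) xSeries
      rw [sub_add_cancel, hC z partialD_z] at h
      rw [eq_neg_of_add_eq_zero_left h.symm]
      exact hx.neg_right
  | mul a b ha hb =>
    rw [map_mul, euler_mul, totalD_mul, add_sub_add_comm, ← sub_mul, ← mul_sub]
    exact dvd_add (ha.mul_right _) (X_pow_dvd_mul_left _ hb)
  | add a b ha hb =>
    rw [map_add, hadd]
    exact dvd_add ha hb

theorem coeff_expD (n : ℕ) (w : H) :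
    (n : H) * coeff n (expD w)
      = ∑ i ∈ range n, partialD (i + 1) (coeff (n - (i + 1)) (expD w)) := by
  have h := X_pow_dvd_iff.1 (euler_expD_dvd n w) n (Nat.lt_succ_self n)
  rw [map_sub, coeff_totalD n n le_rfl, sub_eq_zero] at h
  rw [← h, euler, coeff_mk]

theorem coeff_zero_expD (w : H) : coeff 0 (expD w) = w := by
  induction w using FreeAlgebra.induction with
  | grade0 r =>
    have h : expD (algebraMap ℚ H r) = C (algebraMap ℚ H r) := by
      rw [AlgHom.commutes, PowerSeries.algebraMap_apply]
    rw [h, coeff_zero_C]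
  | grade1 l =>
    cases l with
    | X => rw [show FreeAlgebra.ι ℚ Letter.X = x from rfl, expD_x]; simp [xSeries]
    | Y => rw [show FreeAlgebra.ι ℚ Letter.Y = y from rfl, expD_y]; simp [xSeries, z]
  | mul a b ha hb => rw [map_mul, coeff_mul, Nat.antidiagonal_zero, sum_singleton, ha, hb]
  | add a b ha hb => rw [map_add, map_add, ha, hb]

/-! ### Coefficients of `expD` as derivation relations -/

theorem mem_xHy (w : H) : x * w * y ∈ xHy :=
  ⟨w, by simp [mul_assoc]⟩

theorem partialD_mem_xHy (n : ℕ) {v : H} (hv : v ∈ xHy) : partialD n v ∈ xHy := by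
  obtain ⟨w, rfl⟩ := hv
  have h : partialD n (x * (w * y))
      = x * (z ^ (n - 1) * y * w + partialD n w - w * x * z ^ (n - 1)) * y := by
    rw [partialD_mul, partialD_mul, partialD_x, partialD_y]
    noncomm_ring
  simp only [LinearMap.comp_apply, LinearMap.mulRight_apply, LinearMap.mulLeft_apply, h]
  exact mem_xHy _

theorem mem_of_natCast_mul_mem (S : Submodule ℚ H) {n : ℕ} (hn : n ≠ 0) {v : H}
    (h : (n : H) * v ∈ S) : v ∈ S := by
  have h2 := S.smul_mem ((n : ℚ)⁻¹) h
  rwa [← nsmul_eq_mul, ← Nat.cast_smul_eq_nsmul ℚ, smul_smul,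
    inv_mul_cancel₀ (Nat.cast_ne_zero.2 hn), one_smul] at h2

theorem coeff_expD_mem_xHy {v : H} (hv : v ∈ xHy) (n : ℕ) : coeff n (expD v) ∈ xHy := by
  induction n using Nat.strong_induction_on with
  | _ n ih =>
    rcases Nat.eq_zero_or_pos n with rfl | hn
    · rwa [coeff_zero_expD]
    · refine mem_of_natCast_mul_mem _ hn.ne' ?_
      rw [coeff_expD]
      exact Submodule.sum_mem _ fun i _ => partialD_mem_xHy _ (ih _ (by omega))

theorem coeff_expD_mem_derivationRelations {v : H} (hv : v ∈ xHy) {n : ℕ} (hn : n ≠ 0) :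
    coeff n (expD v) ∈ derivationRelations := by
  refine mem_of_natCast_mul_mem _ hn ?_
  rw [coeff_expD]
  refine Submodule.sum_mem _ fun i _ => ?_
  exact Submodule.mem_iSup_of_mem (i + 1) (Submodule.mem_iSup_of_mem (by omega)
    (Submodule.mem_map_of_mem (coeff_expD_mem_xHy hv _)))

/-! ### Shuffles of powers and their generating series -/

theorem word_replicate (n : ℕ) (l : Letter) :
    word (List.replicate n l) = FreeAlgebra.ι ℚ l ^ n := by
  simp [word]

theorem shuffle_pow (m b : ℕ) : shuffle (x ^ m) (y ^ b)
    = wordShuffle (List.replicate m Letter.X) (List.replicate b Letter.Y) := by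
  rw [← shuffle_word, word_replicate, word_replicate, x, y]

theorem shuffle_pow_zero (m : ℕ) : shuffle (x ^ m) (y ^ 0) = x ^ m := by
  rw [shuffle_pow]
  cases m with
  | zero => simp [wordShuffle, word]
  | succ m =>
    rw [List.replicate_zero, List.replicate_succ, wordShuffle, ← List.replicate_succ,
      word_replicate, x]

theorem shuffle_zero_pow (b : ℕ) : shuffle (x ^ 0) (y ^ b) = y ^ b := by
  rw [shuffle_pow, List.replicate_zero, wordShuffle, word_replicate, y]

theorem shuffle_pow_succ (m b : ℕ) : shuffle (x ^ (m + 1)) (y ^ (b + 1))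
    = x * shuffle (x ^ m) (y ^ (b + 1)) + y * shuffle (x ^ (m + 1)) (y ^ b) := by
  rw [shuffle_pow, shuffle_pow, shuffle_pow]
  simp only [List.replicate_succ, wordShuffle, x, y]

theorem shuffle_pow_eq_sum (m b : ℕ) : shuffle (x ^ (m + 1)) (y ^ b)
    = ∑ p ∈ antidiagonal b, y ^ p.1 * (x * shuffle (x ^ m) (y ^ p.2)) := by
  induction b with
  | zero =>
    rw [Nat.antidiagonal_zero, sum_singleton, shuffle_pow_zero, shuffle_pow_zero, pow_zero, one_mul,
      pow_succ']
  | succ b ih =>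
    rw [shuffle_pow_succ, ih, Nat.sum_antidiagonal_succ, mul_sum]
    simp only [pow_zero, one_mul, pow_succ' y, mul_assoc]

theorem coeff_xSeries_pow (m b : ℕ) :
    coeff b (xSeries ^ (m + 1)) = x * shuffle (x ^ m) (y ^ b) := by
  induction m generalizing b with
  | zero => rw [shuffle_zero_pow]; simp [xSeries]
  | succ m ih =>
    rw [pow_succ', coeff_mul, shuffle_pow_eq_sum, mul_sum]
    refine sum_congr rfl fun p _ => ?_
    rw [ih, xSeries, coeff_mk, mul_assoc]

/-- The extension of `expD` to power series, truncated: `∑_{j ≤ N} expD (v j) X ^ j`. -/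
noncomputable def expDSum (N : ℕ) (v : ℕ → H) : H⟦X⟧ :=
  ∑ j ∈ range (N + 1), expD (v j) * X ^ j

/-- Passing from `v` to the coefficients `v'` of `(1 - X x)⁻¹ y v` multiplies the image under
`expD` by `y`. -/
theorem expDSum_dvd_step (N : ℕ) {v v' : ℕ → H} {c : H} (h0 : v' 0 = y * v 0)
    (hs : ∀ j, v' (j + 1) = x * v' j + y * v (j + 1))
    (h : (X : H⟦X⟧) ^ (N + 1) ∣ expDSum N v - C c) :
    (X : H⟦X⟧) ^ (N + 1) ∣ expDSum N v' - C (y * c) := by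
  apply X_pow_dvd_of_dvd_sub (g := xSeries)
  -- The Xᴺ⁺¹ term is the overflow from truncating at N.
  have h1 : expDSum N v' + xSeries * expD (v' N) * X ^ (N + 1)
      = expD y * expDSum N v + xSeries * (X * expDSum N v') := by
    have h2 : xSeries * (X * expDSum N v')
        = ∑ j ∈ range N, xSeries * expD (v' j) * X ^ (j + 1)
          + xSeries * expD (v' N) * X ^ (N + 1) := by
      rw [← sum_range_succ (fun j => xSeries * expD (v' j) * X ^ (j + 1)), expDSum, X_mul,
        sum_mul, mul_sum]
      simp only [pow_succ, mul_assoc]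
    rw [h2, ← add_assoc, expDSum, expDSum, sum_range_succ', sum_range_succ' _ N, h0]
    simp only [hs, map_add, map_mul, expD_x, add_mul, sum_add_distrib, mul_add, mul_sum,
      mul_assoc]
    abel
  have h3 : C y - expD y = xSeries * (X * C y) := by
    rw [expD_y, z, map_add]
    have := xSeries_eq
    rw [sub_sub_eq_add_sub, add_comm (C x), ← sub_sub, add_sub_right_comm, sub_self, zero_add]
    exact sub_eq_of_eq_add' this
  -- The constant yc satisfies the same recursion as `expDSum N v'`, with c in place of `expDSum N
  -- v`.
  have h4 : expDSum N v' - C (y * c) - xSeries * (X * (expDSum N v' - C (y * c)))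
      = expD y * (expDSum N v - C c) - xSeries * expD (v' N) * X ^ (N + 1) := by
    have h5 : xSeries * (X * C (y * c)) = C (y * c) - expD y * C c := by
      rw [map_mul, ← sub_mul, h3]
      simp only [mul_assoc]
    rw [mul_sub X, mul_sub, mul_sub, h5, ← sub_eq_of_eq_add' (h1.trans (add_comm _ _))]
    abel
  rw [h4]
  exact dvd_sub (X_pow_dvd_mul_left _ h) (X_pow_dvd_mul_left _ dvd_rfl)

theorem expDSum_shuffle_dvd (N a : ℕ) :
    (X : H⟦X⟧) ^ (N + 1) ∣
      expDSum N (fun j => shuffle (x ^ j) (y ^ a) * y) - C (y ^ (a + 1)) := by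
  induction a with
  | zero =>
    -- Starting from the series 1, one step produces (1 - Xx)⁻¹y, the case a = 0.
    have h : (X : H⟦X⟧) ^ (N + 1) ∣ expDSum N (fun j => if j = 0 then 1 else 0) - C 1 := by
      rw [expDSum, sum_range_succ']
      simp
    have := expDSum_dvd_step N (v' := fun j => shuffle (x ^ j) (y ^ 0) * y) ?_ ?_ h
    · simpa using this
    · simp only [shuffle_pow_zero]; simp
    · intro j
      simp only [shuffle_pow_zero]
      simp [pow_succ', mul_assoc]
  | succ a ih =>
    rw [pow_succ' y (a + 1)]
    refine expDSum_dvd_step N ?_ ?_ ih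
    · rw [shuffle_zero_pow, shuffle_zero_pow, pow_succ', mul_assoc]
    · intro j
      simp only [shuffle_pow_succ, add_mul, mul_assoc]

theorem sum_coeff_expD_eq (m a b : ℕ) :
    ∑ j ∈ range (b + 1), coeff (b - j) (expD (x ^ (m + 1) * shuffle (x ^ j) (y ^ a) * y))
      = x * shuffle (x ^ m) (y ^ b) * y ^ (a + 1) := by
  have h := X_pow_dvd_iff.1
    (X_pow_dvd_mul_left (xSeries ^ (m + 1)) (expDSum_shuffle_dvd b a)) b (Nat.lt_succ_self b)
  rw [mul_sub, map_sub, sub_eq_zero, coeff_mul_C, coeff_xSeries_pow, expDSum, mul_sum,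
    map_sum] at h
  rw [← h]
  refine sum_congr rfl fun j hj => ?_
  rw [mul_assoc (x ^ (m + 1)), map_mul, map_pow, expD_x, ← mul_assoc, coeff_mul_X_pow',
    if_pos (Nat.lt_succ_iff.1 (mem_range.1 hj))]

theorem shuffle_sub_shuffle_mem (m a b : ℕ) :
    x * shuffle (x ^ m) (y ^ b) * y ^ (a + 1) - x ^ (m + 1) * shuffle (x ^ b) (y ^ a) * y
      ∈ derivationRelations := by
  rw [← sum_coeff_expD_eq, sum_range_succ, Nat.sub_self, coeff_zero_expD, add_sub_cancel_right]
  refine Submodule.sum_mem _ fun j hj => ?_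
  refine coeff_expD_mem_derivationRelations ?_ (by have := mem_range.1 hj; omega)
  rw [pow_succ', mul_assoc x]
  exact mem_xHy _

end MZV

theorem theorem2p1 (a b k : ℕ) (hk : a + b + 2 ≤ k) :
    MZV.x * MZV.shuffle (MZV.x ^ (k - a - b - 2)) (MZV.y ^ b) * MZV.y ^ (a + 1)
        - MZV.x ^ (k - a - b - 1) * MZV.shuffle (MZV.x ^ b) (MZV.y ^ a) * MZV.y
      ∈ MZV.derivationRelations := by
  obtain ⟨m, rfl⟩ := Nat.exists_eq_add_of_le hk
  rw [show a + b + 2 + m - a - b - 2 = m by omega, show a + b + 2 + m - a - b - 1 = m + 1 by omega]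
  exact MZV.shuffle_sub_shuffle_mem m a b
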